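/- Let $n\ge 0$ be an integer and let $u_0\in\mathcal S'(\mathbb R^n)$ be a tempered distribution. For $t\in\mathbb R$ let $e^{it\Delta}u_0\in\mathcal S'(\mathbb R^n)$ be the solution at time $t$ of the free Schrödinger equation $\partial_t u=i\Delta u$, $u(\cdot,0)=u_0$, i.e. $\widehat{e^{it\Delta}u_0}=e^{-it|\xi|^2}\,\widehat{u_0}$, where $\widehat{\ \cdot\ }$ is the Fourier transform of tempered distributions, normalized by $\widehat f(\xi)=(2\pi)^{-n/2}\int_{\mathbb R^n}e^{-ix\cdot\xi}f(x)\,dx$. Suppose that there are real numbers $t_1\ne t_2$ and $\mu_1,\mu_2>0$ such that $$e^{it_j\Delta}u_0\in L^2(\mathbb R^n,\,e^{2\mu_j|x|^2}dx),\qquad j=1,2.$$ Then there are $A_1,A_2>0$ such that $u_0\in O_2(A_1;A_2)$, i.e. $u_0$ and $\widehat{u_0}$ are functions with $$e^{A_1|x|^2}u_0\in L^2(\mathbb R^n)\quad\text{and}\quad e^{A_2|\xi|^2}\,\widehat{u_0}\in L^2(\mathbb R^n).$$ -/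

import Mathlib

open MeasureTheory
open scoped SchwartzMap ENNReal FourierTransform

noncomputable section

/-! ### The Fourier transform with the normalization `(2π)^{-n/2} ∫ e^{-i x·ξ} f(x) dx` -/

/-- The dilation `x ↦ (2π)⁻¹ x` of `ℝⁿ`. -/
def dilationInvTwoPi (n : ℕ) :
    EuclideanSpace ℝ (Fin n) ≃L[ℝ] EuclideanSpace ℝ (Fin n) :=
  (LinearEquiv.smulOfNeZero ℝ (EuclideanSpace ℝ (Fin n)) ((2 * Real.pi)⁻¹)
    (inv_ne_zero Real.two_pi_pos.ne')).toContinuousLinearEquiv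

/-- The unitary Fourier transform in angular frequency on Schwartz functions,
`φ̂(ξ) = (2π)^{-n/2} ∫ e^{-i x·ξ} φ(x) dx`, obtained from Mathlib's `𝓕`
(which has the kernel `e^{-2π i x·ξ}`) by rescaling; see `hatSchwartz_apply`. -/
def hatSchwartz (n : ℕ) :
    𝓢(EuclideanSpace ℝ (Fin n), ℂ) →L[ℂ] 𝓢(EuclideanSpace ℝ (Fin n), ℂ) :=
  (((2 * Real.pi) ^ (-(n : ℝ) / 2) : ℝ) : ℂ) •
    (SchwartzMap.compCLMOfContinuousLinearEquiv ℂ (dilationInvTwoPi n) ∘L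
      FourierTransform.fourierCLM ℂ 𝓢(EuclideanSpace ℝ (Fin n), ℂ))

theorem hatSchwartz_apply (n : ℕ) (φ : 𝓢(EuclideanSpace ℝ (Fin n), ℂ))
    (ξ : EuclideanSpace ℝ (Fin n)) :
    hatSchwartz n φ ξ = (((2 * Real.pi) ^ (-(n : ℝ) / 2) : ℝ) : ℂ) *
      ∫ x, Complex.exp (-Complex.I * ((inner ℝ x ξ : ℝ) : ℂ)) * φ x := by
  have h : hatSchwartz n φ ξ = (((2 * Real.pi) ^ (-(n : ℝ) / 2) : ℝ) : ℂ) *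
      (𝓕 (φ : EuclideanSpace ℝ (Fin n) → ℂ)) ((2 * Real.pi)⁻¹ • ξ) := rfl
  rw [h, Real.fourier_eq']
  congr 1
  refine integral_congr_ae (Filter.Eventually.of_forall fun x => ?_)
  have hpi : (2 * Real.pi) ≠ 0 := Real.two_pi_pos.ne'
  have : -2 * Real.pi * inner ℝ x ((2 * Real.pi)⁻¹ • ξ) = -inner ℝ x ξ := by
    rw [inner_smul_right]; field_simp
  simp only [this, smul_eq_mul]
  congr 2
  push_cast
  ring

/-- The Fourier transform of a tempered distribution, by duality: `⟨û, φ⟩ = ⟨u, φ̂⟩`. -/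
def hatTempered (n : ℕ) (u : 𝓢'(EuclideanSpace ℝ (Fin n), ℂ)) :
    𝓢'(EuclideanSpace ℝ (Fin n), ℂ) :=
  PointwiseConvergenceCLM.precomp ℂ (hatSchwartz n) u

theorem hatTempered_apply (n : ℕ) (u : 𝓢'(EuclideanSpace ℝ (Fin n), ℂ))
    (φ : 𝓢(EuclideanSpace ℝ (Fin n), ℂ)) :
    hatTempered n u φ = u (hatSchwartz n φ) := rfl

/-! ### The free Schrödinger group -/

/-- The symbol of `e^{itΔ}` in the frequency variable of Mathlib's `𝓕`. Here `Δ` has the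
symbol `-|2πξ|²`, so `e^{itΔ}` has the symbol `e^{-it|2πξ|²}`. -/
def freeSymbol (n : ℕ) (t : ℝ) (ξ : EuclideanSpace ℝ (Fin n)) : ℂ :=
  Complex.exp (((-(t * (2 * Real.pi) ^ 2) * ‖ξ‖ ^ 2 : ℝ) : ℂ) * Complex.I)

theorem hasTemperateGrowth_exp_mul_I :
    (fun s : ℝ => Complex.exp ((s : ℂ) * Complex.I)).HasTemperateGrowth := by
  have hd : ∀ k : ℕ, iteratedDeriv k (fun s : ℝ => Complex.exp ((s : ℂ) * Complex.I)) =
      fun s : ℝ => Complex.I ^ k * Complex.exp ((s : ℂ) * Complex.I) := by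
    intro k
    induction k with
    | zero => simp
    | succ k ih =>
      rw [iteratedDeriv_succ, ih]
      funext s
      have h1 : HasDerivAt (fun s : ℝ => (s : ℂ) * Complex.I) Complex.I s := by
        simpa using (Complex.ofRealCLM.hasDerivAt (x := s)).mul_const Complex.I
      have h2 := (h1.cexp).const_mul (Complex.I ^ k)
      rw [h2.deriv]
      ring
  refine ⟨?_, fun k => ⟨0, 1, fun s => ?_⟩⟩
  · exact Complex.contDiff_exp.comp (Complex.ofRealCLM.contDiff.mul contDiff_const)
  · rw [norm_iteratedFDeriv_eq_norm_iteratedDeriv, hd]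
    simp [Complex.norm_exp_ofReal_mul_I]

/-- The symbol is smooth with polynomially bounded derivatives, so that it acts on tempered
distributions by multiplication. -/
theorem freeSymbol_hasTemperateGrowth (n : ℕ) (t : ℝ) :
    (freeSymbol n t).HasTemperateGrowth := by
  have h : (fun ξ : EuclideanSpace ℝ (Fin n) =>
      -(t * (2 * Real.pi) ^ 2) * ‖ξ‖ ^ 2).HasTemperateGrowth :=
    (Function.HasTemperateGrowth.const _).mul
      (Function.hasTemperateGrowth_norm_sq (EuclideanSpace ℝ (Fin n)))
  exact hasTemperateGrowth_exp_mul_I.comp h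

/-- The free Schrödinger evolution `e^{itΔ} u` of a tempered distribution `u`, that is, the
Fourier multiplier with the symbol of `e^{itΔ}`. -/
def freeSchrodinger (n : ℕ) (t : ℝ) (u : 𝓢'(EuclideanSpace ℝ (Fin n), ℂ)) :
    𝓢'(EuclideanSpace ℝ (Fin n), ℂ) :=
  TemperedDistribution.fourierMultiplierCLM ℂ (freeSymbol n t) u

/-! ### Gaussian decay of tempered distributions -/

/-- The tempered distribution `u` is given by integration against the function `f`. -/
def IsGivenBy {n : ℕ} (u : 𝓢'(EuclideanSpace ℝ (Fin n), ℂ))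
    (f : EuclideanSpace ℝ (Fin n) → ℂ) : Prop :=
  ∀ φ : 𝓢(EuclideanSpace ℝ (Fin n), ℂ),
    Integrable (fun x => φ x * f x) ∧ u φ = ∫ x, φ x * f x

/-- `u ∈ L²(e^{b|x|²} dx)`: the tempered distribution `u` is a function which is square
integrable with respect to the measure `e^{b|x|²} dx`. -/
def MemGaussianWeightedL2 {n : ℕ} (b : ℝ) (u : 𝓢'(EuclideanSpace ℝ (Fin n), ℂ)) : Prop :=
  ∃ f : EuclideanSpace ℝ (Fin n) → ℂ, IsGivenBy u f ∧
    MemLp f 2 (volume.withDensity fun x => ENNReal.ofReal (Real.exp (b * ‖x‖ ^ 2)))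

/-- `e^{A|·|²} u ∈ L^p(ℝⁿ)`: the tempered distribution `u` is a function `f` for which
`x ↦ e^{A|x|²} f(x)` is in `L^p`. -/
def GaussianMulMemLp {n : ℕ} (A : ℝ) (p : ℝ≥0∞) (u : 𝓢'(EuclideanSpace ℝ (Fin n), ℂ)) : Prop :=
  ∃ f : EuclideanSpace ℝ (Fin n) → ℂ, IsGivenBy u f ∧
    MemLp (fun x => (Real.exp (A * ‖x‖ ^ 2) : ℂ) * f x) p volume

/-- `u = O_{p,q}(A₁; A₂)`: `e^{A₁|·|²} u ∈ L^p` and `e^{A₂|·|²} û ∈ L^q`. -/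
def IsGaussianO {n : ℕ} (p q : ℝ≥0∞) (A₁ A₂ : ℝ) (u : 𝓢'(EuclideanSpace ℝ (Fin n), ℂ)) : Prop :=
  GaussianMulMemLp A₁ p u ∧ GaussianMulMemLp A₂ q (hatTempered n u)

end

/-!
Since `𝓕 (e^{itΔ} u₀) = e^{-it|2πη|²} 𝓕 u₀`, the Gabor transform of `𝓕 u₀` (its short-time Fourier
transform with Gaussian windows, a function on phase space) at a point `(x, ξ)` is an average of
`e^{itΔ} u₀` over a Gaussian neighbourhood of the point `x + 4πtξ` that a free particle starting
from `(x, ξ)` reaches at time `t`. Gaussian decay of `e^{itΔ} u₀` therefore gives Gaussian decay of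
the Gabor transform in the variable `x + 4πtξ`. For two distinct times these two variables determine
`(x, ξ)`, so there is Gaussian decay in all of phase space, and integrating out `x` or `ξ` recovers
Gaussian decay of `𝓕 u₀` or of `u₀`.
-/

section GaussianDecay

open Asymptotics

variable {X Y E V W : Type*} [NormedAddCommGroup E] [NormedAddCommGroup V] [NormedAddCommGroup W]

/-- `f` is bounded by a multiple of `x ↦ e^{-c ‖ℓ x‖²}` for some `c > 0`. The rate `c` is not
recorded, so that it can shrink from one step of an argument to the next. -/
def HasGaussianDecayAlong (ℓ : X → V) (f : X → E) : Prop :=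
  ∃ c : ℝ, 0 < c ∧ f =O[⊤] fun x => Real.exp (-c * ‖ℓ x‖ ^ 2)

/-- Gaussian decay in all directions: `f` is bounded by a multiple of `x ↦ e^{-c ‖x‖²}` for some
`c > 0`. -/
abbrev HasGaussianDecay (f : V → E) : Prop := HasGaussianDecayAlong id f

namespace HasGaussianDecayAlong

variable {f : X → E} {ℓ : X → V}

theorem comp (hf : HasGaussianDecayAlong ℓ f) (k : Y → X) :
    HasGaussianDecayAlong (ℓ ∘ k) (f ∘ k) := by
  obtain ⟨c, hc, h⟩ := hf
  exact ⟨c, hc, h.comp_tendsto Filter.tendsto_top⟩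

theorem mono (hf : HasGaussianDecayAlong ℓ f) {F : Type*} [NormedAddCommGroup F] {g : X → F}
    (hgf : ∀ x, ‖g x‖ ≤ ‖f x‖) : HasGaussianDecayAlong ℓ g := by
  obtain ⟨c, hc, h⟩ := hf
  exact ⟨c, hc, (isBigO_of_le _ hgf).trans h⟩

theorem const_smul {𝕜 : Type*} [NormedField 𝕜] [NormedSpace 𝕜 E]
    (hf : HasGaussianDecayAlong ℓ f) (r : 𝕜) :
    HasGaussianDecayAlong ℓ fun x => r • f x := by
  obtain ⟨c, hc, h⟩ := hf
  exact ⟨c, hc, h.const_smul_left r⟩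

theorem of_norm_le (hf : HasGaussianDecayAlong ℓ f) {ℓ' : X → W} {K : ℝ}
    (hℓ : ∀ x, ‖ℓ' x‖ ≤ K * ‖ℓ x‖) : HasGaussianDecayAlong ℓ' f := by
  obtain ⟨c, hc, h⟩ := hf
  refine ⟨c / (K ^ 2 + 1), by positivity, h.trans (isBigO_of_le _ fun x => ?_)⟩
  have hsq : ‖ℓ' x‖ ^ 2 ≤ (K ^ 2 + 1) * ‖ℓ x‖ ^ 2 := by
    nlinarith [pow_le_pow_left₀ (norm_nonneg _) (hℓ x) 2, sq_nonneg ‖ℓ x‖]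
  rw [Real.norm_of_nonneg (Real.exp_pos _).le, Real.norm_of_nonneg (Real.exp_pos _).le,
    Real.exp_le_exp, neg_mul, neg_mul, neg_le_neg_iff, div_mul_eq_mul_div,
    div_le_iff₀ (by positivity)]
  nlinarith

theorem prodMk {ℓ' : X → W} (hf : HasGaussianDecayAlong ℓ f) (hf' : HasGaussianDecayAlong ℓ' f) :
    HasGaussianDecayAlong (fun x => (ℓ x, ℓ' x)) f := by
  obtain ⟨c, hc, h⟩ := hf
  obtain ⟨d, hd, h'⟩ := hf'
  obtain ⟨C, hC0, hC⟩ := h.exists_nonneg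
  obtain ⟨D, -, hD⟩ := h'.exists_nonneg
  refine ⟨min c d, lt_min hc hd, isBigO_top.2 ⟨max C D, fun x => ?_⟩⟩
  rcases max_choice ‖ℓ x‖ ‖ℓ' x‖ with hmax | hmax <;> rw [Prod.norm_mk, hmax]
  · refine (isBigOWith_top.1 hC x).trans ?_
    simp only [Real.norm_of_nonneg (Real.exp_pos _).le]
    gcongr
    exacts [le_max_left C D, min_le_left c d]
  · refine (isBigOWith_top.1 hD x).trans ?_
    simp only [Real.norm_of_nonneg (Real.exp_pos _).le]
    gcongr
    exacts [le_max_right C D, min_le_right c d]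

theorem hasGaussianDecay_of_injective [NormedSpace ℝ V] [NormedSpace ℝ W] [FiniteDimensional ℝ V]
    {L : V →ₗ[ℝ] W} (hL : Function.Injective L) {f : V → E} (hf : HasGaussianDecayAlong L f) :
    HasGaussianDecay f := by
  obtain ⟨K, -, hK⟩ := L.exists_antilipschitzWith (LinearMap.ker_eq_bot.2 hL)
  exact hf.of_norm_le (hK.le_mul_norm L.map_zero)

theorem hasGaussianDecay_of_add_smul [NormedSpace ℝ V] [FiniteDimensional ℝ V] {p q : ℝ}
    (hpq : p ≠ q) {f : V × V → E} (hp : HasGaussianDecayAlong (fun z => z.1 + p • z.2) f)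
    (hq : HasGaussianDecayAlong (fun z => z.1 + q • z.2) f) : HasGaussianDecay f := by
  let L (r : ℝ) : V × V →ₗ[ℝ] V := LinearMap.fst ℝ V V + r • LinearMap.snd ℝ V V
  refine hasGaussianDecay_of_injective (L := (L p).prod (L q)) ?_ (hp.prodMk hq)
  refine (injective_iff_map_eq_zero _).2 fun ⟨x, ξ⟩ h => ?_
  obtain ⟨hx, hξ⟩ : x + p • ξ = 0 ∧ x + q • ξ = 0 := by simpa [L] using h
  have hsub : (p - q) • ξ = 0 := by rw [sub_smul, ← add_sub_add_left_eq_sub, hx, hξ, sub_zero]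
  obtain rfl : ξ = 0 := (smul_eq_zero_iff_right (sub_ne_zero.2 hpq)).1 hsub
  simpa using hx

end HasGaussianDecayAlong

namespace HasGaussianDecay

variable {f : V → E}

theorem comp_injective [NormedSpace ℝ V] [NormedSpace ℝ W] [FiniteDimensional ℝ W]
    (hf : HasGaussianDecay f) {L : W →ₗ[ℝ] V} (hL : Function.Injective L) :
    HasGaussianDecay (f ∘ L) :=
  (hf.comp L).hasGaussianDecay_of_injective hL

theorem comp_smul [NormedSpace ℝ V] [FiniteDimensional ℝ V] (hf : HasGaussianDecay f) {r : ℝ}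
    (hr : r ≠ 0) : HasGaussianDecay fun x => f (r • x) :=
  hf.comp_injective (L := r • LinearMap.id) (smul_right_injective V hr)

theorem comp_mk_right {F : V × W → E} (hF : HasGaussianDecay F) (w : W) :
    HasGaussianDecay fun x => F (x, w) :=
  (hF.comp (·, w)).of_norm_le (K := 1) fun x => by simp

theorem exists_exp_mul_sq_norm_smul [NormedSpace ℝ E] (hf : HasGaussianDecay f) :
    ∃ A : ℝ, 0 < A ∧ HasGaussianDecay fun x => Real.exp (A * ‖x‖ ^ 2) • f x := by
  obtain ⟨c, hc, h⟩ := hf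
  refine ⟨c / 2, half_pos hc, c / 2, half_pos hc,
    ((isBigO_refl (fun x : V => Real.exp (c / 2 * ‖x‖ ^ 2)) ⊤).smul h).congr_right fun x => ?_⟩
  rw [smul_eq_mul, ← Real.exp_add, id]
  ring_nf

end HasGaussianDecay

theorem exp_neg_mul_sq_norm_sub_le {k κ c : ℝ} (hk : 2 * c ≤ k) (hκ : 2 * c ≤ κ) (hc : 0 ≤ c)
    (z y : V) :
    Real.exp (-k * ‖z - y‖ ^ 2) ≤ Real.exp (-c * ‖z‖ ^ 2) * Real.exp (κ * ‖y‖ ^ 2) := by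
  rw [← Real.exp_add, Real.exp_le_exp]
  have hsq : ‖z‖ ^ 2 ≤ 2 * ‖z - y‖ ^ 2 + 2 * ‖y‖ ^ 2 := by
    have htri : ‖z‖ ≤ ‖z - y‖ + ‖y‖ := by simpa using norm_add_le (z - y) y
    nlinarith [sq_nonneg (‖z - y‖ - ‖y‖), norm_nonneg z]
  nlinarith [sq_nonneg ‖z - y‖, sq_nonneg ‖y‖, mul_le_mul_of_nonneg_left hsq hc]

variable [InnerProductSpace ℝ V] [FiniteDimensional ℝ V] [MeasurableSpace V] [BorelSpace V]

theorem integrable_exp_neg_mul_sq_norm {c : ℝ} (hc : 0 < c) :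
    Integrable fun x : V => Real.exp (-c * ‖x‖ ^ 2) :=
  .of_integral_ne_zero <| by
    rw [GaussianFourier.integral_rexp_neg_mul_sq_norm hc]
    positivity

theorem memLp_exp_neg_mul_sq_norm {c : ℝ} (hc : 0 < c) (p : ℝ≥0∞) :
    MemLp (fun x : V => Real.exp (-c * ‖x‖ ^ 2)) p := by
  have hm : AEStronglyMeasurable (fun x : V => Real.exp (-c * ‖x‖ ^ 2)) volume :=
    Continuous.aestronglyMeasurable (by fun_prop)
  rcases eq_or_ne p ∞ with rfl | hp
  · refine memLp_top_of_bound hm 1 (.of_forall fun x => ?_)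
    rw [Real.norm_of_nonneg (Real.exp_pos _).le, Real.exp_le_one_iff, neg_mul, neg_nonpos]
    positivity
  rcases eq_or_ne p 0 with rfl | hp₀
  · exact memLp_zero_iff_aestronglyMeasurable.2 hm
  refine (integrable_norm_rpow_iff hm hp₀ hp).1 ?_
  refine (integrable_exp_neg_mul_sq_norm (mul_pos hc (ENNReal.toReal_pos hp₀ hp))).congr
    (.of_forall fun x => ?_)
  simp only [Real.norm_of_nonneg (Real.exp_pos _).le, ← Real.exp_mul]
  ring_nf

namespace HasGaussianDecay

theorem memLp {f : V → E} (hf : HasGaussianDecay f) (hfm : AEStronglyMeasurable f) (p : ℝ≥0∞) :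
    MemLp f p := by
  obtain ⟨c, hc, h⟩ := hf
  obtain ⟨C, hC⟩ := isBigO_top.1 h
  exact (memLp_exp_neg_mul_sq_norm hc p).of_le_mul hfm (.of_forall hC)

theorem integrable {f : V → E} (hf : HasGaussianDecay f) (hfm : AEStronglyMeasurable f) :
    Integrable f :=
  memLp_one_iff_integrable.1 (hf.memLp hfm 1)

theorem integral_norm_prod_left {F : V × V → E} (hF : HasGaussianDecay F) :
    HasGaussianDecay fun x => ∫ ξ, ‖F (x, ξ)‖ := by
  obtain ⟨c, hc, h⟩ := hF
  obtain ⟨C, hC₀, hC⟩ := h.exists_nonneg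
  refine ⟨c / 2, half_pos hc, isBigO_top.2
    ⟨C * ∫ ξ : V, Real.exp (-(c / 2) * ‖ξ‖ ^ 2), fun x => ?_⟩⟩
  have hbound (ξ : V) : ‖F (x, ξ)‖ ≤
      C * Real.exp (-(c / 2) * ‖x‖ ^ 2) * Real.exp (-(c / 2) * ‖ξ‖ ^ 2) := by
    refine (isBigOWith_top.1 hC (x, ξ)).trans ?_
    rw [Real.norm_of_nonneg (Real.exp_pos _).le, mul_assoc, ← Real.exp_add]
    gcongr
    have hx := pow_le_pow_left₀ (norm_nonneg _) (norm_fst_le (x, ξ)) 2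
    have hξ := pow_le_pow_left₀ (norm_nonneg _) (norm_snd_le (x, ξ)) 2
    simp only [id]
    nlinarith
  refine (norm_integral_le_of_norm_le
    ((integrable_exp_neg_mul_sq_norm (half_pos hc)).const_mul _)
    (.of_forall fun ξ => (norm_norm _).trans_le (hbound ξ))).trans_eq ?_
  rw [integral_const_mul, Real.norm_of_nonneg (Real.exp_pos _).le, mul_right_comm, id]

theorem integral_norm_prod_right {F : V × V → E} (hF : HasGaussianDecay F) :
    HasGaussianDecay fun ξ => ∫ x, ‖F (x, ξ)‖ :=
  HasGaussianDecay.integral_norm_prod_left (F := F ∘ Prod.swap) <|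
    hF.comp_injective (L := (LinearEquiv.prodComm ℝ V V).toLinearMap)
      (LinearEquiv.prodComm ℝ V V).injective

end HasGaussianDecay

/-- `e^{κ |y|²} f` is integrable for some `κ > 0`: the averaged form of Gaussian decay that a
weighted `L²` bound provides. -/
def HasGaussianMoment [NormedSpace ℝ E] (f : V → E) : Prop :=
  ∃ κ : ℝ, 0 < κ ∧ Integrable fun y => Real.exp (κ * ‖y‖ ^ 2) • f y

namespace HasGaussianMoment

theorem integrable [NormedSpace ℝ E] {f : V → E} (hf : HasGaussianMoment f) : Integrable f := by
  obtain ⟨κ, hκ, hi⟩ := hf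
  refine (hi.bdd_smul (φ := fun y => Real.exp (-κ * ‖y‖ ^ 2)) 1
    (Continuous.aestronglyMeasurable (by fun_prop)) (.of_forall fun y => ?_)).congr
    (.of_forall fun y => ?_)
  · rw [Real.norm_of_nonneg (Real.exp_pos _).le, Real.exp_le_one_iff, neg_mul, neg_nonpos]
    positivity
  · simp [smul_smul, ← Real.exp_add]

theorem integral_smul [NormedSpace ℂ E] {f : V → E} (hf : HasGaussianMoment f) {ℓ : X → V}
    {k : X × V → ℂ} (hk : HasGaussianDecayAlong (fun p : X × V => ℓ p.1 - p.2) k) :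
    HasGaussianDecayAlong ℓ fun x => ∫ y, k (x, y) • f y := by
  obtain ⟨κ, hκ, hi⟩ := hf
  obtain ⟨d, hd, h⟩ := hk
  obtain ⟨C, hC₀, hC⟩ := h.exists_nonneg
  have hc : 0 < min d κ / 2 := half_pos (lt_min hd hκ)
  refine ⟨min d κ / 2, hc, isBigO_top.2
    ⟨C * ∫ y, ‖Real.exp (κ * ‖y‖ ^ 2) • f y‖, fun x => ?_⟩⟩
  rw [Real.norm_of_nonneg (Real.exp_pos _).le, mul_right_comm, ← integral_const_mul]
  refine norm_integral_le_of_norm_le (hi.norm.const_mul _) (.of_forall fun y => ?_)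
  have hexp := exp_neg_mul_sq_norm_sub_le (k := d) (κ := κ) (by linarith [min_le_left d κ])
    (by linarith [min_le_right d κ]) hc.le (ℓ x) y
  have hky : ‖k (x, y)‖ ≤ C * Real.exp (-d * ‖ℓ x - y‖ ^ 2) := by
    simpa using isBigOWith_top.1 hC (x, y)
  calc ‖k (x, y) • f y‖
      ≤ C * (Real.exp (-(min d κ / 2) * ‖ℓ x‖ ^ 2) * Real.exp (κ * ‖y‖ ^ 2)) * ‖f y‖ := by
        rw [norm_smul]
        gcongr
        exact hky.trans (by gcongr)
    _ = _ := by
        rw [norm_smul, Real.norm_of_nonneg (Real.exp_pos _).le]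
        ring

end HasGaussianMoment

theorem memLp_two_exp_smul_of_withDensity [NormedSpace ℝ E] {b : ℝ} {f : V → E}
    (hf : MemLp f 2 (volume.withDensity fun x => ENNReal.ofReal (Real.exp (b * ‖x‖ ^ 2)))) :
    MemLp (fun x => Real.exp (b / 2 * ‖x‖ ^ 2) • f x) 2 := by
  have hw : Measurable fun x : V => ENNReal.ofReal (Real.exp (b * ‖x‖ ^ 2)) := by fun_prop
  have hfm : AEStronglyMeasurable f := hf.1.mono_ac <|
    withDensity_absolutelyContinuous' hw.aemeasurable (.of_forall fun x => by simp [Real.exp_pos])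
  have hexp : Continuous fun x : V => Real.exp (b / 2 * ‖x‖ ^ 2) := by fun_prop
  refine (memLp_two_iff_integrable_sq_norm (hexp.aestronglyMeasurable.smul hfm)).2 <|
    ((integrable_withDensity_iff hw (.of_forall fun x => ENNReal.ofReal_lt_top)).1
      ((memLp_two_iff_integrable_sq_norm hf.1).1 hf)).congr (.of_forall fun x => ?_)
  simp only [Pi.smul_apply', ENNReal.toReal_ofReal (Real.exp_pos _).le, norm_smul,
    mul_pow, ← Real.exp_nat_mul, Real.norm_of_nonneg (Real.exp_pos _).le]
  push_cast
  ring_nf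

theorem hasGaussianMoment_of_memLp_withDensity [NormedSpace ℝ E] {b : ℝ} (hb : 0 < b)
    {f : V → E}
    (hf : MemLp f 2 (volume.withDensity fun x => ENNReal.ofReal (Real.exp (b * ‖x‖ ^ 2)))) :
    HasGaussianMoment f := by
  have hb₄ : 0 < b / 4 := by positivity
  have hL1 := (memLp_two_exp_smul_of_withDensity hf).smul (r := 1)
    (memLp_exp_neg_mul_sq_norm hb₄ 2)
  refine ⟨b / 4, hb₄, (memLp_one_iff_integrable.1 hL1).congr (.of_forall fun x => ?_)⟩
  simp only [Pi.smul_apply', smul_smul, ← Real.exp_add]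
  ring_nf

end GaussianDecay

section Fourier

open Complex (I)
open scoped Real

variable {V E : Type*} [NormedAddCommGroup V] [InnerProductSpace ℝ V] [FiniteDimensional ℝ V]
  [MeasurableSpace V] [BorelSpace V] [NormedAddCommGroup E] [NormedSpace ℂ E]

theorem continuous_fourier {f : V → E} (hf : Integrable f) : Continuous (𝓕 f) :=
  VectorFourier.fourierIntegral_continuous Real.continuous_fourierChar (L := innerₗ V)
    continuous_inner hf

theorem continuous_fourierInv {f : V → E} (hf : Integrable f) : Continuous (𝓕⁻ f) := by
  rw [funext (Real.fourierInv_eq_fourier_neg f)]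
  exact (continuous_fourier hf).comp continuous_neg

theorem norm_fourier_le_integral_norm (f : V → E) (ξ : V) : ‖𝓕 f ξ‖ ≤ ∫ x, ‖f x‖ :=
  VectorFourier.norm_fourierIntegral_le_integral_norm _ _ _ _ _

theorem norm_fourier_comp_add_right (f : V → E) (v₀ ξ : V) :
    ‖𝓕 (fun v => f (v + v₀)) ξ‖ = ‖𝓕 f ξ‖ := by
  have h := congrFun (VectorFourier.fourierIntegral_comp_add_right Real.fourierChar volume
    (innerₗ V) f v₀) ξ
  exact (congrArg norm h).trans (Circle.norm_smul _ _)

theorem fourier_fourierInv_eq_of_integrable [CompleteSpace E] {F : V → E} (hF : Continuous F)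
    (hFi : Integrable F) (hF' : Integrable (𝓕⁻ F)) : 𝓕 (𝓕⁻ F) = F :=
  hF.fourier_fourierInv_eq hFi <| hF'.comp_neg.congr <| .of_forall fun x => by
    simp only [Real.fourierInv_eq_fourier_neg, neg_neg]

/-- The dilation `r` lets one identity serve `𝓕`, `𝓕⁻ = 𝓕 ∘ (-1 • ·)`, and the angular-frequency
transform. -/
theorem integral_fourier_smul_smul_eq [CompleteSpace E] (r : ℝ) {f : V → ℂ} {g : V → E}
    (hf : Integrable f) (hg : Integrable g) :
    ∫ ξ, 𝓕 f (r • ξ) • g ξ = ∫ x, f x • 𝓕 g (r • x) := by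
  have h := VectorFourier.integral_fourierIntegral_smul_eq_flip (L := r • innerₗ V)
    Real.continuous_fourierChar (by simpa using continuous_inner.const_mul r) hf hg
  simpa [VectorFourier.fourierIntegral, Real.fourier_eq, inner_smul_right, real_inner_comm] using h

theorem integral_fourierInv_smul_eq [CompleteSpace E] {f : V → ℂ} {g : V → E}
    (hf : Integrable f) (hg : Integrable g) :
    ∫ ξ, 𝓕⁻ f ξ • g ξ = ∫ x, f x • 𝓕⁻ g x := by
  simpa [Real.fourierInv_eq_fourier_neg] using integral_fourier_smul_smul_eq (-1) hf hg

theorem fourierInv_smul_fourier [CompleteSpace E] {h : V → ℂ} {f : V → E} (hh : Integrable h)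
    (hf : Integrable f) (x : V) :
    𝓕⁻ (fun η => h η • 𝓕 f η) x = ∫ y, 𝓕⁻ h (x - y) • f y := by
  have hm : Integrable fun η => Complex.exp ((2 * π * inner ℝ η x : ℝ) * I) * h η :=
    hh.bdd_mul (c := 1) (Continuous.aestronglyMeasurable (by fun_prop))
      (.of_forall fun η => (Complex.norm_exp_ofReal_mul_I _).le)
  have hmod (y : V) :
      𝓕 (fun η => Complex.exp ((2 * π * inner ℝ η x : ℝ) * I) * h η) y = 𝓕⁻ h (x - y) := by
    simp only [Real.fourier_eq', Real.fourierInv_eq', smul_eq_mul, ← mul_assoc, ← Complex.exp_add,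
      inner_sub_right]
    refine integral_congr_ae (.of_forall fun η => ?_)
    push_cast
    ring_nf
  have hadj := integral_fourier_smul_smul_eq 1 hm hf
  simp only [one_smul, hmod] at hadj
  rw [hadj, Real.fourierInv_eq']
  simp only [mul_smul]

end Fourier

section Gabor

open Complex (I)
open scoped Real

variable {V E : Type*} [NormedAddCommGroup V] [NormedAddCommGroup E]

/-- The quadratic phase factor `e^{i a |η|²}`, by which the Schrödinger group acts on the Fourier
side. -/
noncomputable def chirp (a : ℝ) (η : V) : ℂ :=
  Complex.exp ((a * ‖η‖ ^ 2 : ℝ) * I)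

/-- The Gaussian `e^{-π |η - ξ|²}` of height one and integral one, centred at `ξ`. -/
noncomputable def gaussianWindow (ξ η : V) : ℂ :=
  (Real.exp (-π * ‖η - ξ‖ ^ 2) : ℝ)

theorem norm_chirp (a : ℝ) (η : V) : ‖chirp a η‖ = 1 :=
  Complex.norm_exp_ofReal_mul_I _

theorem continuous_chirp (a : ℝ) : Continuous (chirp a : V → ℂ) := by
  unfold chirp
  fun_prop

theorem continuous_gaussianWindow : Continuous fun p : V × V => gaussianWindow p.1 p.2 := by
  unfold gaussianWindow
  fun_prop

variable [InnerProductSpace ℝ V]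

theorem gaussianWindow_mul_chirp_add (a : ℝ) (ξ v : V) :
    gaussianWindow ξ (v + ξ) * chirp a (v + ξ) = chirp a ξ * Complex.exp
      (-(π - a * I) * ‖v‖ ^ 2 + 2 * π * I * inner ℝ ((a / π) • ξ) v) := by
  have hsq : (‖v + ξ‖ : ℝ) ^ 2 = ‖v‖ ^ 2 + 2 * inner ℝ ξ v + ‖ξ‖ ^ 2 := by
    rw [norm_add_sq_real, real_inner_comm]
  have hπ : (π : ℂ) ≠ 0 := mod_cast Real.pi_ne_zero
  rw [gaussianWindow, chirp, chirp, add_sub_cancel_right, hsq, real_inner_smul_left,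
    Complex.ofReal_exp, ← Complex.exp_add, ← Complex.exp_add]
  congr 1
  push_cast
  field_simp
  ring

variable [FiniteDimensional ℝ V] [MeasurableSpace V] [BorelSpace V]
  [NormedSpace ℂ E]

theorem integrable_gaussianWindow (ξ : V) : Integrable (gaussianWindow ξ) :=
  ((integrable_exp_neg_mul_sq_norm Real.pi_pos).comp_sub_right ξ).ofReal

theorem integral_gaussianWindow (ξ : V) : ∫ η, gaussianWindow ξ η = 1 := by
  simp only [gaussianWindow]
  rw [integral_complex_ofReal, integral_sub_right_eq_self (fun η : V => Real.exp (-π * ‖η‖ ^ 2)) ξ,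
    GaussianFourier.integral_rexp_neg_mul_sq_norm Real.pi_pos, div_self Real.pi_ne_zero,
    Real.one_rpow, Complex.ofReal_one]

/-- The Gabor transform of `F` at a point `(x, ξ)` of phase space: the short-time Fourier transform
with a Gaussian window centred at the frequency `ξ`. Since `F` is thought of as a function of
frequency, the windowed function is transformed by `𝓕⁻`. -/
noncomputable def gaborTransform (F : V → E) (p : V × V) : E :=
  𝓕⁻ (fun η => gaussianWindow p.2 η • F η) p.1

theorem integrable_gaussianWindow_smul {F : V → E} (hF : Continuous F) {M : ℝ}
    (hM : ∀ η, ‖F η‖ ≤ M) (ξ : V) : Integrable fun η => gaussianWindow ξ η • F η :=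
  (integrable_gaussianWindow ξ).smul_bdd M hF.aestronglyMeasurable (.of_forall hM)

theorem norm_le_integral_norm_gaborTransform [CompleteSpace E] {F : V → E} (hF : Continuous F)
    {M : ℝ} (hM : ∀ η, ‖F η‖ ≤ M) (ξ : V) (hG : Integrable fun x => gaborTransform F (x, ξ)) :
    ‖F ξ‖ ≤ ∫ x, ‖gaborTransform F (x, ξ)‖ := by
  have hc : Continuous fun η => gaussianWindow ξ η • F η :=
    (continuous_gaussianWindow.comp (.prodMk_right ξ)).smul hF
  have hinv : 𝓕 (fun x => gaborTransform F (x, ξ)) ξ = F ξ := by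
    refine (congrFun (fourier_fourierInv_eq_of_integrable hc
      (integrable_gaussianWindow_smul hF hM ξ) hG) ξ).trans ?_
    simp [gaussianWindow]
  rw [← hinv]
  exact norm_fourier_le_integral_norm _ ξ

theorem fourierInv_eq_integral_gaborTransform [CompleteSpace E] {F : V → E} (hF : Integrable F)
    (x : V) : 𝓕⁻ F x = ∫ ξ, gaborTransform F (x, ξ) := by
  let modF (η : V) : E := Complex.exp ((2 * π * inner ℝ η x : ℝ) * I) • F η
  have hmod : Integrable modF :=
    hF.bdd_smul 1 (Continuous.aestronglyMeasurable (by fun_prop))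
      (.of_forall fun η => (Complex.norm_exp_ofReal_mul_I _).le)
  have hconv (ξ : V) : gaborTransform F (x, ξ) =
      convolution modF (gaussianWindow 0) (ContinuousLinearMap.lsmul ℂ ℂ).flip volume ξ := by
    rw [gaborTransform, Real.fourierInv_eq', convolution_def]
    refine integral_congr_ae (.of_forall fun η => ?_)
    simp only [gaussianWindow, norm_sub_rev η, ContinuousLinearMap.flip_apply,
      ContinuousLinearMap.lsmul_apply, sub_zero, modF]
    rw [smul_comm]
  simp only [hconv]
  rw [integral_convolution _ hmod (integrable_gaussianWindow 0), integral_gaussianWindow,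
    Real.fourierInv_eq']
  simp [modF]

theorem norm_gaborTransform_chirp (a : ℝ) (x ξ : V) :
    ‖gaborTransform (chirp a) (x, ξ)‖ =
      ‖(π / (π - a * I) : ℂ) ^ (Module.finrank ℝ V / 2 : ℂ)‖ *
        Real.exp (-(π ^ 3 / Complex.normSq (π - a * I)) * ‖x + (a / π) • ξ‖ ^ 2) := by
  calc ‖gaborTransform (chirp a) (x, ξ)‖
      = ‖𝓕 (fun v => gaussianWindow ξ (v + ξ) * chirp a (v + ξ)) (-x)‖ := by
        rw [gaborTransform, Real.fourierInv_eq_fourier_neg,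
          norm_fourier_comp_add_right fun η => gaussianWindow ξ η * chirp a η]
        rfl
    _ = ‖𝓕 (fun v : V => Complex.exp
          (-(π - a * I) * ‖v‖ ^ 2 + 2 * π * I * inner ℝ ((a / π) • ξ) v)) (-x)‖ := by
        simp only [gaussianWindow_mul_chirp_add, Real.fourier_eq', smul_eq_mul,
          mul_left_comm _ (chirp a ξ), integral_const_mul, norm_mul, norm_chirp, one_mul]
    _ = _ := by
        rw [fourier_gaussian_innerProductSpace' (by simpa using Real.pi_pos), norm_mul,
          Complex.norm_exp, sub_neg_eq_add, add_comm _ x]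
        congr 2
        have hnum : -(π : ℂ) ^ 2 * ‖x + (a / π) • ξ‖ ^ 2 =
            (-(π ^ 2 * ‖x + (a / π) • ξ‖ ^ 2) : ℝ) := by push_cast; ring
        have hb : (π - a * I : ℂ).re = π := by simp
        rw [hnum, Complex.div_re, Complex.ofReal_re, Complex.ofReal_im, hb]
        ring

theorem hasGaussianDecayAlong_gaborTransform_chirp (a : ℝ) :
    HasGaussianDecayAlong (fun z : V × V => z.1 + (a / π) • z.2) (gaborTransform (chirp a)) := by
  have hb : (π - a * I : ℂ) ≠ 0 := fun h => Real.pi_ne_zero (by simpa using congrArg Complex.re h)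
  exact ⟨_, div_pos (pow_pos Real.pi_pos 3) (Complex.normSq_pos.2 hb), .of_bound _ <|
    .of_forall fun z => by
      rw [Real.norm_of_nonneg (Real.exp_pos _).le, ← norm_gaborTransform_chirp]⟩

/-- The chirped Fourier transform `e^{i a |η|²} 𝓕 f`. If `f` is the free Schrödinger evolution of
`u` up to time `t`, then this is `𝓕 u` for `a = t (2π)²`. -/
noncomputable def chirpedFourier (a : ℝ) (f : V → E) (η : V) : E :=
  chirp a η • 𝓕 f η

theorem norm_chirpedFourier_le (a : ℝ) (f : V → E) (η : V) :
    ‖chirpedFourier a f η‖ ≤ ∫ x, ‖f x‖ := by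
  rw [chirpedFourier, norm_smul, norm_chirp, one_mul]
  exact norm_fourier_le_integral_norm f η

theorem continuous_chirpedFourier (a : ℝ) {f : V → E} (hf : Integrable f) :
    Continuous (chirpedFourier a f) :=
  (continuous_chirp a).smul (continuous_fourier hf)

theorem gaborTransform_chirpedFourier [CompleteSpace E] (a : ℝ) {f : V → E}
    (hf : Integrable f) (z : V × V) :
    gaborTransform (chirpedFourier a f) z =
      ∫ y, gaborTransform (chirp a) (z.1 - y, z.2) • f y := by
  have hw : Integrable fun η => gaussianWindow z.2 η • chirp a η :=
    integrable_gaussianWindow_smul (continuous_chirp a) (fun η => (norm_chirp a η).le) z.2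
  rw [gaborTransform]
  simp only [chirpedFourier, ← smul_assoc]
  exact fourierInv_smul_fourier hw hf z.1

theorem HasGaussianMoment.hasGaussianDecayAlong_gaborTransform [CompleteSpace E] (a : ℝ)
    {f : V → E} (hf : HasGaussianMoment f) :
    HasGaussianDecayAlong (fun z : V × V => z.1 + (a / π) • z.2)
      (gaborTransform (chirpedFourier a f)) := by
  rw [funext (gaborTransform_chirpedFourier a hf.integrable)]
  refine hf.integral_smul (((hasGaussianDecayAlong_gaborTransform_chirp a).comp
    fun p : (V × V) × V => (p.1.1 - p.2, p.1.2)).of_norm_le (K := 1) fun p => ?_)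
  rw [one_mul, Function.comp_apply, sub_add_eq_add_sub]

theorem hasGaussianDecay_of_gaborTransform [CompleteSpace E] {F : V → E} (hF : Continuous F)
    {M : ℝ} (hM : ∀ η, ‖F η‖ ≤ M) (hG : HasGaussianDecay (gaborTransform F)) :
    HasGaussianDecay F ∧ HasGaussianDecay (𝓕⁻ F) := by
  have hslice (ξ : V) : Integrable fun x => gaborTransform F (x, ξ) :=
    (hG.comp_mk_right ξ).integrable
      (continuous_fourierInv (integrable_gaussianWindow_smul hF hM ξ)).aestronglyMeasurable
  have hdecay : HasGaussianDecay F := hG.integral_norm_prod_right.mono fun ξ =>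
    (norm_le_integral_norm_gaborTransform hF hM ξ (hslice ξ)).trans (le_abs_self _)
  refine ⟨hdecay, hG.integral_norm_prod_left.mono fun x => ?_⟩
  rw [fourierInv_eq_integral_gaborTransform (hdecay.integrable hF.aestronglyMeasurable)]
  exact (norm_integral_le_integral_norm _).trans (le_abs_self _)

theorem hasGaussianDecay_of_chirpedFourier_eq [CompleteSpace E] {a b : ℝ} (hab : a ≠ b)
    {f g : V → E} (hf : HasGaussianMoment f) (hg : HasGaussianMoment g)
    (hfg : chirpedFourier a f = chirpedFourier b g) :
    HasGaussianDecay (chirpedFourier a f) ∧ HasGaussianDecay (𝓕⁻ (chirpedFourier a f)) := by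
  have hslope : a / π ≠ b / π := fun h => hab ((div_left_inj' Real.pi_ne_zero).1 h)
  refine hasGaussianDecay_of_gaborTransform (continuous_chirpedFourier a hf.integrable)
    (norm_chirpedFourier_le a f) (.hasGaussianDecay_of_add_smul hslope
      (hf.hasGaussianDecayAlong_gaborTransform a) ?_)
  rw [hfg]
  exact hg.hasGaussianDecayAlong_gaborTransform b

end Gabor

section TemperedDistribution

open scoped Real

variable {n : ℕ} {u : 𝓢'(EuclideanSpace ℝ (Fin n), ℂ)} {f : EuclideanSpace ℝ (Fin n) → ℂ}

theorem MemGaussianWeightedL2.exists_isGivenBy_hasGaussianMoment {b : ℝ} (hb : 0 < b)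
    (hu : MemGaussianWeightedL2 b u) :
    ∃ f : EuclideanSpace ℝ (Fin n) → ℂ, IsGivenBy u f ∧ HasGaussianMoment f := by
  obtain ⟨f, hf, hmem⟩ := hu
  exact ⟨f, hf, hasGaussianMoment_of_memLp_withDensity hb hmem⟩

theorem isGivenBy_of_bounded (hf : AEStronglyMeasurable f) {M : ℝ} (hM : ∀ x, ‖f x‖ ≤ M)
    (h : ∀ φ : 𝓢(EuclideanSpace ℝ (Fin n), ℂ), u φ = ∫ x, φ x * f x) : IsGivenBy u f :=
  fun φ => ⟨φ.integrable.mul_bdd hf (.of_forall hM), h φ⟩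

namespace IsGivenBy

theorem eq_of_continuous {g : EuclideanSpace ℝ (Fin n) → ℂ} (huf : IsGivenBy u f)
    (hug : IsGivenBy u g) (hf : Continuous f) (hg : Continuous g) : f = g := by
  refine (Continuous.ae_eq_iff_eq volume hf hg).1 (ae_eq_of_integral_contDiff_smul_eq
    hf.locallyIntegrable hg.locallyIntegrable fun χ hχ hχs => ?_)
  have hsmooth : ContDiff ℝ (⊤ : ℕ∞) fun x => (χ x : ℂ) := Complex.ofRealCLM.contDiff.comp hχ
  have hsupp : HasCompactSupport fun x => (χ x : ℂ) := hχs.comp_left Complex.ofReal_zero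
  let φ : 𝓢(EuclideanSpace ℝ (Fin n), ℂ) := hsupp.toSchwartzMap hsmooth
  simpa [φ, Complex.real_smul] using (huf φ).2.symm.trans (hug φ).2

theorem smulLeftCLM {g : EuclideanSpace ℝ (Fin n) → ℂ} (hg : g.HasTemperateGrowth)
    (hu : IsGivenBy u f) : IsGivenBy (TemperedDistribution.smulLeftCLM ℂ g u) (g * f) := by
  intro φ
  have hφ := hu (SchwartzMap.smulLeftCLM ℂ g φ)
  simpa only [SchwartzMap.smulLeftCLM_apply_apply hg, smul_eq_mul, mul_assoc, mul_left_comm (g _),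
    Pi.mul_apply, TemperedDistribution.smulLeftCLM_apply_apply] using hφ

theorem fourier (hu : IsGivenBy u f) (hf : Integrable f) : IsGivenBy (𝓕 u) (𝓕 f) := by
  refine isGivenBy_of_bounded (continuous_fourier hf).aestronglyMeasurable
    (norm_fourier_le_integral_norm f) fun φ => ?_
  rw [TemperedDistribution.fourier_apply, (hu _).2, SchwartzMap.fourier_coe]
  simpa using integral_fourier_smul_smul_eq 1 φ.integrable hf

theorem fourierInv (hu : IsGivenBy u f) (hf : Integrable f) : IsGivenBy (𝓕⁻ u) (𝓕⁻ f) := by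
  refine isGivenBy_of_bounded (M := ∫ x, ‖f x‖) (continuous_fourierInv hf).aestronglyMeasurable
    (fun x => ?_) fun φ => ?_
  · rw [Real.fourierInv_eq_fourier_neg]
    exact norm_fourier_le_integral_norm f _
  · rw [TemperedDistribution.fourierInv_apply, (hu _).2, SchwartzMap.fourierInv_coe]
    exact integral_fourierInv_smul_eq φ.integrable hf

theorem hatTempered (hu : IsGivenBy u f) (hf : Integrable f) :
    IsGivenBy (hatTempered n u) fun ξ =>
      (((2 * π) ^ (-(n : ℝ) / 2) : ℝ) : ℂ) • 𝓕 f ((2 * π)⁻¹ • ξ) := by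
  set K : ℂ := (((2 * π) ^ (-(n : ℝ) / 2) : ℝ) : ℂ)
  refine isGivenBy_of_bounded (M := ‖K‖ * ∫ x, ‖f x‖)
    (((continuous_fourier hf).comp (continuous_const_smul _)).const_smul K).aestronglyMeasurable
    (fun ξ => ?_) fun φ => ?_
  · rw [norm_smul]
    gcongr
    exact norm_fourier_le_integral_norm f _
  · have hhat (ξ : EuclideanSpace ℝ (Fin n)) : hatSchwartz n φ ξ = K * 𝓕 ⇑φ ((2 * π)⁻¹ • ξ) := rfl
    have hadj := integral_fourier_smul_smul_eq (2 * π)⁻¹ φ.integrable hf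
    simp only [smul_eq_mul] at hadj
    simp only [hatTempered_apply, (hu _).2, hhat, smul_eq_mul, mul_assoc, mul_left_comm _ K,
      integral_const_mul, hadj]

theorem gaussianMulMemLp (hu : IsGivenBy u f) (hfm : AEStronglyMeasurable f)
    (hf : HasGaussianDecay f) (p : ℝ≥0∞) : ∃ A : ℝ, 0 < A ∧ GaussianMulMemLp A p u := by
  obtain ⟨A, hA, hdecay⟩ := hf.exists_exp_mul_sq_norm_smul
  have hexp : Continuous fun x : EuclideanSpace ℝ (Fin n) => Real.exp (A * ‖x‖ ^ 2) := by fun_prop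
  refine ⟨A, hA, f, hu, ?_⟩
  simpa only [Complex.real_smul] using hdecay.memLp (hexp.aestronglyMeasurable.smul hfm) p

end IsGivenBy

theorem freeSchrodinger_neg_freeSchrodinger (t : ℝ) (u : 𝓢'(EuclideanSpace ℝ (Fin n), ℂ)) :
    freeSchrodinger n (-t) (freeSchrodinger n t u) = u := by
  have hmul : freeSymbol n t * freeSymbol n (-t) = fun _ => 1 := by
    funext ξ
    rw [Pi.mul_apply, freeSymbol, freeSymbol, ← Complex.exp_add, ← Complex.exp_zero]
    congr 1
    push_cast
    ring
  rw [freeSchrodinger, freeSchrodinger,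
    TemperedDistribution.fourierMultiplierCLM_fourierMultiplierCLM_apply
      (freeSymbol_hasTemperateGrowth n _) (freeSymbol_hasTemperateGrowth n _), hmul]
  simp

theorem IsGivenBy.fourier_freeSchrodinger (t : ℝ) (hu : IsGivenBy u f) (hf : Integrable f) :
    IsGivenBy (𝓕 (freeSchrodinger n t u)) (chirpedFourier (-(t * (2 * π) ^ 2)) f) := by
  rw [freeSchrodinger, TemperedDistribution.fourierMultiplierCLM_apply,
    FourierTransform.fourier_fourierInv_eq]
  exact (hu.fourier hf).smulLeftCLM (freeSymbol_hasTemperateGrowth n t)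

theorem IsGivenBy.fourier_of_freeSchrodinger {t : ℝ} (hu : IsGivenBy (freeSchrodinger n t u) f)
    (hf : Integrable f) : IsGivenBy (𝓕 u) (chirpedFourier (t * (2 * π) ^ 2) f) := by
  simpa only [freeSchrodinger_neg_freeSchrodinger, neg_mul, neg_neg] using
    hu.fourier_freeSchrodinger (-t) hf

theorem IsGivenBy.exists_isGaussianO {F : EuclideanSpace ℝ (Fin n) → ℂ} (hu : IsGivenBy (𝓕 u) F)
    (hFc : Continuous F) (hF : HasGaussianDecay F) (hF' : HasGaussianDecay (𝓕⁻ F)) (p q : ℝ≥0∞) :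
    ∃ A₁ A₂ : ℝ, 0 < A₁ ∧ 0 < A₂ ∧ IsGaussianO p q A₁ A₂ u := by
  have hFi : Integrable F := hF.integrable hFc.aestronglyMeasurable
  have hF'c : Continuous (𝓕⁻ F) := continuous_fourierInv hFi
  have hF'i : Integrable (𝓕⁻ F) := hF'.integrable hF'c.aestronglyMeasurable
  have hu' : IsGivenBy u (𝓕⁻ F) := by
    simpa only [FourierTransform.fourierInv_fourier_eq] using hu.fourierInv hFi
  have hhat := hu'.hatTempered hF'i
  rw [fourier_fourierInv_eq_of_integrable hFc hFi hF'i] at hhat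
  obtain ⟨A₁, hA₁, h₁⟩ := hu'.gaussianMulMemLp hF'c.aestronglyMeasurable hF' p
  obtain ⟨A₂, hA₂, h₂⟩ := hhat.gaussianMulMemLp
    (Continuous.aestronglyMeasurable (by fun_prop))
    ((hF.comp_smul (inv_ne_zero Real.two_pi_pos.ne')).const_smul _) q
  exact ⟨A₁, A₂, hA₁, hA₂, h₁, h₂⟩

end TemperedDistribution

theorem corollary2p1 (n : ℕ) (u₀ : 𝓢'(EuclideanSpace ℝ (Fin n), ℂ))
    (t₁ t₂ : ℝ) (ht : t₁ ≠ t₂) (μ₁ μ₂ : ℝ) (hμ₁ : 0 < μ₁) (hμ₂ : 0 < μ₂)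
    (h₁ : MemGaussianWeightedL2 (2 * μ₁) (freeSchrodinger n t₁ u₀))
    (h₂ : MemGaussianWeightedL2 (2 * μ₂) (freeSchrodinger n t₂ u₀)) :
    ∃ A₁ A₂ : ℝ, 0 < A₁ ∧ 0 < A₂ ∧ IsGaussianO 2 2 A₁ A₂ u₀ := by
  obtain ⟨f₁, hu₁, hf₁⟩ := h₁.exists_isGivenBy_hasGaussianMoment (mul_pos two_pos hμ₁)
  obtain ⟨f₂, hu₂, hf₂⟩ := h₂.exists_isGivenBy_hasGaussianMoment (mul_pos two_pos hμ₂)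
  have hF₁ := hu₁.fourier_of_freeSchrodinger hf₁.integrable
  have hF₂ := hu₂.fourier_of_freeSchrodinger hf₂.integrable
  have hc₁ := continuous_chirpedFourier (t₁ * (2 * Real.pi) ^ 2) hf₁.integrable
  have hc₂ := continuous_chirpedFourier (t₂ * (2 * Real.pi) ^ 2) hf₂.integrable
  have hrates : t₁ * (2 * Real.pi) ^ 2 ≠ t₂ * (2 * Real.pi) ^ 2 :=
    (mul_left_injective₀ (pow_ne_zero 2 Real.two_pi_pos.ne')).ne ht
  obtain ⟨hdecay, hdecay'⟩ := hasGaussianDecay_of_chirpedFourier_eq hrates hf₁ hf₂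
    (hF₁.eq_of_continuous hF₂ hc₁ hc₂)
  exact hF₁.exists_isGaussianO hc₁ hdecay hdecay' 2 2
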